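/- Call a set $A\subset\mathbb R$ residual if $\mathbb R\setminus A$ is meager. A function $f:\mathbb R\to\mathbb R$ has the Baire property if $f^{-1}[U]$ has the Baire property (i.e. is the symmetric difference of an open set and a meager set) for every open $U\subset\mathbb R$; let $\mathcal Ba$ be the class of all such functions. For $p,q\in\mathbb R$ let $I(p,q)$ denote the open interval with end-points $p$ and $q$ (in either order). A function $f:\mathbb R\to\mathbb R$ is a Świątkowski function if for all $a<b$ with $f(a)\neq f(b)$ there is a continuity point $x\in(a,b)$ of $f$ with $f(x)\in I(f(a),f(b))$; let $\mathcal S$ be the class of all Świątkowski functions. For $A\subset\mathbb R$, an interval $J$ and $\varepsilon\ge 0$, say that $f$ satisfies $S(J,A,\varepsilon)$ if for all $a,b\in J$ with $f(a)<f(b)$ there is $x\in A\cap I(a,b)$ with $f(x)\in(f(a)-\varepsilon,f(b)+\varepsilon)$; say that $f$ satisfies $S(A,\varepsilon)$ if the union of all open intervals $J$ for which $S(J,A,\varepsilon)$ holds is dense in $\mathbb R$. Let $\mathfrak S$ be the class of all $f\in\mathcal Ba$ which satisfy $S(A,\varepsilon)$ for every residual set $A\subset\mathbb R$ and every $\varepsilon>0$.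 For a family $\mathcal F$ of real-valued functions let $\mathrm{LIM}(\mathcal F)$ be the family of all pointwise limits of sequences from $\mathcal F$, and put $\mathcal B_0(\mathcal F)=\mathcal F$ and $\mathcal B_\alpha(\mathcal F)=\mathrm{LIM}\bigl(\bigcup_{\beta<\alpha}\mathcal B_\beta(\mathcal F)\bigr)$ for ordinals $\alpha>0$. The Baire order of $\mathcal F$ is the least ordinal $\alpha\le\omega_1$ such that $\mathcal B_{\alpha+1}(\mathcal F)=\mathcal B_\alpha(\mathcal F)$. **Theorem.** (i) $\mathcal B_1(\mathcal S)=\mathfrak S$; (ii) $\mathcal B_\alpha(\mathcal S)=\mathcal Ba$ for every ordinal $\alpha>1$. Hence the Baire order of the family $\mathcal S$ of all Świątkowski functions is equal to $2$. -/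

import Mathlib

/-- `LIM F`: all pointwise limits of sequences of functions from `F`. -/
def LIM {X : Type*} (F : Set (X → ℝ)) : Set (X → ℝ) :=
  {f | ∃ u : ℕ → X → ℝ, (∀ n, u n ∈ F) ∧
    ∀ x, Filter.Tendsto (fun n => u n x) Filter.atTop (nhds (f x))}

/-- The Baire classes generated by `F`: `B_0(F) = F`, and
`B_α(F) = LIM (⋃ β < α, B_β(F))` for `α > 0`. -/
noncomputable def baireClass {X : Type*} (F : Set (X → ℝ)) (α : Ordinal.{0}) : Set (X → ℝ) :=
  if α = 0 then F else LIM (⋃ β : Set.Iio α, baireClass F β.1)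
termination_by α
decreasing_by exact β.2

theorem baireClass_zero {X : Type*} (F : Set (X → ℝ)) : baireClass F 0 = F := by
  rw [baireClass, if_pos rfl]

theorem baireClass_of_pos {X : Type*} (F : Set (X → ℝ)) {α : Ordinal.{0}} (hα : 0 < α) :
    baireClass F α = LIM (⋃ β : Set.Iio α, baireClass F β.1) := by
  rw [baireClass, if_neg hα.ne']

/-- The Baire order of `F`: the least ordinal `α ≤ ω₁` at which the Baire classes stop growing,
that is, `B_{α+1}(F) = B_α(F)`. -/
noncomputable def baireOrder {X : Type*} (F : Set (X → ℝ)) : Ordinal.{0} :=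
  sInf {α : Ordinal.{0} | α ≤ Ordinal.omega 1 ∧
    baireClass F (Order.succ α) = baireClass F α}

/-- The class of all functions with the Baire property: preimages of open sets have the
Baire property. -/
def bairePropertyFunctions : Set (ℝ → ℝ) :=
  {f | ∀ U : Set ℝ, IsOpen U → BaireMeasurableSet (f ⁻¹' U)}

/-- The class of all Świątkowski functions. Here `Set.uIoo y z` is the open interval with
end-points `y` and `z`, in either order. -/
def swiatkowskiFunctions : Set (ℝ → ℝ) :=
  {f | ∀ a b : ℝ, a < b → f a ≠ f b →
    ∃ x ∈ Set.Ioo a b, ContinuousAt f x ∧ f x ∈ Set.uIoo (f a) (f b)}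

/-- The condition `S(J, A, ε)` for `f`. -/
def CondSOn (f : ℝ → ℝ) (J A : Set ℝ) (ε : ℝ) : Prop :=
  ∀ a ∈ J, ∀ b ∈ J, f a < f b →
    ∃ x ∈ A ∩ Set.uIoo a b, f x ∈ Set.Ioo (f a - ε) (f b + ε)

/-- The condition `S(A, ε)` for `f`: the union of all open intervals `J` (bounded or not) for
which `S(J, A, ε)` holds is dense in `ℝ`. -/
def CondS (f : ℝ → ℝ) (A : Set ℝ) (ε : ℝ) : Prop :=
  Dense (⋃₀ {J : Set ℝ | IsOpen J ∧ J.OrdConnected ∧ CondSOn f J A ε})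

/-- The class `𝔖`: functions with the Baire property that satisfy `S(A, ε)` for all residual
sets `A` and all `ε > 0`. -/
def frakS : Set (ℝ → ℝ) :=
  {f | f ∈ bairePropertyFunctions ∧ ∀ A ∈ residual ℝ, ∀ ε : ℝ, 0 < ε → CondS f A ε}

open Set Filter Topology

/-! A function has the Baire property iff it is continuous on a residual set; for Świątkowski
functions the continuity points themselves form one.

Limits of Świątkowski functions lie in `frakS`: by Baire category, on small intervals the
approximants are uniformly close to the limit on a residual set of common continuity points inside
`A`, so the intermediate point supplied by one approximant serves, up to `ε`, for the limit.

For the converse, let `f` in `frakS` be continuous on a residual `G`. Take families `C n` of short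
disjoint open intervals with dense decreasing unions that shrink into `G`, such that on each `J` in
`C n` the restriction of `f` to `G` oscillates little and `CondSOn` holds with small error. Keep `f`
off `⋃₀ C n`, and on each `J` put a continuous function that runs through its whole range near both
ends. The range must be small for convergence, yet large enough to meet the interval between two
values of `f`. It is a ball about a value of `f` on `G ∩ J`, with radius governed by how deep in the
scheme `J` lies; `CondSOn` makes that radius suffice (`IntervalScheme.mem_swiatkowskiFunctions`).

Constants on the intervals of such a scheme approximate any function with the Baire property from
within `frakS`, so the second class is everything. Two explicit functions show that neither
inclusion is an equality. -/

/-! ### Functions with the Baire property -/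

theorem BaireMeasurableSet.of_forall_residual_iff {X : Type*} [TopologicalSpace X] {s t G : Set X}
    (hG : G ∈ residual X) (ht : IsOpen t) (h : ∀ x ∈ G, x ∈ s ↔ x ∈ t) :
    BaireMeasurableSet s := by
  refine ht.baireMeasurableSet.congr ?_
  rw [Filter.eventuallyEq_set]
  filter_upwards [hG] with x hx using (h x hx).symm

/-- The preimage of each set of a countable basis is open up to a meager set; discarding these
countably many meager sets leaves `G`. -/
theorem mem_bairePropertyFunctions_iff {f : ℝ → ℝ} :
    f ∈ bairePropertyFunctions ↔ ∃ G ∈ residual ℝ, ContinuousOn f G := by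
  constructor
  · intro hf
    obtain ⟨b, hbc, -, hb⟩ := TopologicalSpace.exists_countable_basis ℝ
    have h : ∀ B ∈ b, ∃ O, IsOpen O ∧ ∀ᶠ x in residual ℝ, x ∈ f ⁻¹' B ↔ x ∈ O := by
      intro B hB
      obtain ⟨O, hO, hfO⟩ := (hf B (hb.isOpen hB)).residualEq_isOpen
      exact ⟨O, hO, Filter.eventuallyEq_set.1 hfO⟩
    choose! O hO hfO using h
    refine ⟨{x | ∀ B ∈ b, x ∈ f ⁻¹' B ↔ x ∈ O B},
      (eventually_countable_ball hbc).2 hfO, ?_⟩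
    intro x hx
    rw [ContinuousWithinAt, hb.nhds_hasBasis.tendsto_right_iff]
    rintro B ⟨hB, hxB⟩
    have hxO : x ∈ O B := (hx B hB).1 hxB
    filter_upwards [self_mem_nhdsWithin, mem_nhdsWithin_of_mem_nhds ((hO B hB).mem_nhds hxO)]
      with y hy hyO
    exact (hy B hB).2 hyO
  · rintro ⟨G, hG, hf⟩ U hU
    obtain ⟨V, hV, hVU⟩ := continuousOn_iff'.1 hf U hU
    refine .of_forall_residual_iff hG hV fun x hx => ?_
    have := congrArg (x ∈ ·) hVU
    simpa [hx] using this

/-- Sets with the Baire property form a σ-algebra, so this is closure of measurable functions under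
pointwise limits. -/
theorem LIM_bairePropertyFunctions_subset :
    LIM bairePropertyFunctions ⊆ bairePropertyFunctions := by
  rintro f ⟨u, hu, hlim⟩
  have hm : ∀ g : ℝ → ℝ, g ∈ bairePropertyFunctions →
      @Measurable _ _ (eventuallyMeasurableSpace (borel ℝ) (residual ℝ)) _ g := by
    intro g hg
    exact @measurable_of_isOpen _ _ _ _ _ (eventuallyMeasurableSpace (borel ℝ) (residual ℝ)) _ hg
  have hf : @Measurable _ _ (eventuallyMeasurableSpace (borel ℝ) (residual ℝ)) _ f := by
    refine @measurable_of_tendsto_metrizable _ _ (eventuallyMeasurableSpace (borel ℝ) (residual ℝ))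
      _ _ _ _ u f (fun n => hm _ (hu n)) (tendsto_pi_nhds.2 hlim)
  exact fun U hU => hf hU.measurableSet

theorem subset_LIM {X : Type*} (F : Set (X → ℝ)) : F ⊆ LIM F :=
  fun f hf => ⟨fun _ => f, fun _ => hf, fun _ => tendsto_const_nhds⟩

theorem LIM_mono {X : Type*} {F F' : Set (X → ℝ)} (h : F ⊆ F') : LIM F ⊆ LIM F' :=
  fun _ ⟨u, hu, hl⟩ => ⟨u, fun n => h (hu n), hl⟩

theorem LIM_bairePropertyFunctions : LIM bairePropertyFunctions = bairePropertyFunctions :=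
  LIM_bairePropertyFunctions_subset.antisymm (subset_LIM _)

/-! ### Limits of Świątkowski functions -/

/-- On an interval without continuity points the Świątkowski condition would force `f` to be
constant, hence continuous. -/
theorem setOf_continuousAt_mem_residual {f : ℝ → ℝ} (hf : f ∈ swiatkowskiFunctions) :
    {x | ContinuousAt f x} ∈ residual ℝ := by
  refine residual_of_dense_Gδ (IsGδ.setOfPred_continuousAt f) (dense_iff_exists_between.2 ?_)
  intro a b hab
  by_contra! h
  have hc : ∀ x ∈ Ioo a b, ∀ y ∈ Ioo a b, x < y → f x = f y := by
    intro x hx y hy hxy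
    by_contra hne
    obtain ⟨z, hz, hzc, -⟩ := hf x y hxy hne
    exact (h z hzc (hx.1.trans hz.1)).not_gt (hz.2.trans hy.2)
  obtain ⟨m, hm⟩ := exists_between hab
  refine (h m ?_ hm.1).not_gt hm.2
  have : f =ᶠ[𝓝 m] fun _ => f m := by
    filter_upwards [Ioo_mem_nhds hm.1 hm.2] with y hy
    rcases lt_trichotomy y m with hlt | rfl | hlt
    · exact hc y hy m hm hlt
    · rfl
    · exact (hc m hm y hy hlt).symm
  exact continuousAt_const.congr this.symm

theorem swiatkowskiFunctions_subset_bairePropertyFunctions :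
    swiatkowskiFunctions ⊆ bairePropertyFunctions := fun _ hf =>
  mem_bairePropertyFunctions_iff.2
    ⟨_, setOf_continuousAt_mem_residual hf, fun _ hx => hx.continuousWithinAt⟩

/-- If pointwise convergent functions `u n` are continuous at all points of a residual set, then on
a subinterval of any given interval they are eventually uniformly close to the limit on that set. -/
theorem exists_Ioo_forall_abs_sub_le {u : ℕ → ℝ → ℝ} {f : ℝ → ℝ}
    (hlim : ∀ x, Tendsto (fun n => u n x) atTop (𝓝 (f x))) {B : Set ℝ} (hB : B ∈ residual ℝ)
    (hc : ∀ n, ∀ x ∈ B, ContinuousAt (u n) x) {ε : ℝ} (hε : 0 < ε) {O : Set ℝ} (hO : IsOpen O)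
    (hne : O.Nonempty) :
    ∃ a b N, a < b ∧ Ioo a b ⊆ O ∧ ∀ n ≥ N, ∀ x ∈ B ∩ Ioo a b, |u n x - f x| ≤ ε := by
  set T : ℕ → Set ℝ := fun N => {x ∈ B | ∀ n ≥ N, ∀ m ≥ N, |u n x - u m x| ≤ ε} with hT
  have hcov : B ⊆ ⋃ N, T N := by
    intro x hx
    obtain ⟨N, hN⟩ := Metric.cauchySeq_iff.1 (hlim x).cauchySeq ε hε
    exact mem_iUnion.2 ⟨N, hx, fun n hn m hm => (hN n hn m hm).le⟩
  have hNot : ∃ N, (interior (closure (T N)) ∩ O).Nonempty := by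
    by_contra! h
    -- Only density of `T N` inside `O` is excluded; adding the exterior of `O` makes these open
    -- sets dense in the whole line.
    have hd : ∀ N, (closure (T N))ᶜ ∪ (closure O)ᶜ ∈ residual ℝ := by
      intro N
      refine residual_of_dense_open (isClosed_closure.isOpen_compl.union
        isClosed_closure.isOpen_compl) ?_
      rw [← compl_inter, ← interior_eq_empty_iff_dense_compl, interior_inter]
      by_contra hne'
      obtain ⟨x, hx1, hx2⟩ := nonempty_iff_ne_empty.2 hne'
      obtain ⟨y, hy1, hy2⟩ := mem_closure_iff.1 (interior_subset hx2) _ isOpen_interior hx1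
      exact (h N).subset ⟨hy1, hy2⟩
    have hres : B ∩ ⋂ N, ((closure (T N))ᶜ ∪ (closure O)ᶜ) ∈ residual ℝ :=
      inter_mem hB (countable_iInter_mem.2 hd)
    obtain ⟨x, hxO, hxB, hx⟩ := (dense_of_mem_residual hres).inter_open_nonempty O hO hne
    obtain ⟨N, hN⟩ := mem_iUnion.1 (hcov hxB)
    rcases mem_iInter.1 hx N with h1 | h1
    · exact h1 (subset_closure hN)
    · exact h1 (subset_closure hxO)
  obtain ⟨N, x, hx⟩ := hNot
  obtain ⟨a, b, hxab, hab⟩ := mem_nhds_iff_exists_Ioo_subset.1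
    ((isOpen_interior.inter hO).mem_nhds hx)
  refine ⟨a, b, N, hxab.1.trans hxab.2, fun y hy => (hab hy).2, ?_⟩
  rintro n hn y ⟨hyB, hy⟩
  -- The bound holds on `T N`, which is dense near `y`, and passes to `y` by continuity of `u n` and
  -- `u m` there.
  have key : ∀ m ≥ N, |u n y - u m y| ≤ ε := by
    intro m hm
    have hcont : ContinuousAt (fun z => |u n z - u m z|) y := ((hc n y hyB).sub (hc m y hyB)).abs
    by_contra! hlt
    have hev : ∀ᶠ z in 𝓝 y, ε < |u n z - u m z| := hcont.eventually (lt_mem_nhds hlt)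
    obtain ⟨z, hz1, hz2⟩ := mem_closure_iff_nhds.1 (interior_subset (hab hy).1) _ hev
    exact (not_le.2 hz1) (hz2.2 n hn m hm)
  have hl : Tendsto (fun m => |u n y - u m y|) atTop (𝓝 |u n y - f y|) :=
    (tendsto_const_nhds.sub (hlim y)).abs
  exact le_of_tendsto hl (eventually_atTop.2 ⟨N, key⟩)

theorem LIM_swiatkowskiFunctions_subset_frakS : LIM swiatkowskiFunctions ⊆ frakS := by
  rintro f ⟨u, hu, hlim⟩
  refine ⟨LIM_bairePropertyFunctions_subset
    ⟨u, fun n => swiatkowskiFunctions_subset_bairePropertyFunctions (hu n), hlim⟩, ?_⟩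
  intro A hA ε hε
  set B : Set ℝ := A ∩ ⋂ n, {x | ContinuousAt (u n) x} with hBdef
  have hB : B ∈ residual ℝ := inter_mem hA
    (countable_iInter_mem.2 fun n => setOf_continuousAt_mem_residual (hu n))
  have hBc : ∀ n, ∀ x ∈ B, ContinuousAt (u n) x := fun n x hx => mem_iInter.1 hx.2 n
  have hBd := dense_of_mem_residual hB
  refine dense_iff_inter_open.2 fun O hO hne => ?_
  obtain ⟨l, r, N, hlr, hsub, hN⟩ :=
    exists_Ioo_forall_abs_sub_le hlim hB hBc (half_pos hε) hO hne
  obtain ⟨m, hm⟩ := exists_between hlr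
  refine ⟨m, hsub hm, Ioo l r, ⟨isOpen_Ioo, ordConnected_Ioo, ?_⟩, hm⟩
  intro a ha b hb hab
  -- One `ε / 2` is spent at the end-points `a`, `b`, the other on the uniform estimate at the
  -- intermediate point.
  have hev : ∀ᶠ n in atTop, N ≤ n ∧ u n a < u n b ∧ f a - ε / 2 < u n a ∧ u n b < f b + ε / 2 := by
    filter_upwards [eventually_ge_atTop N, (hlim a).eventually_lt (hlim b) hab,
      (hlim a).eventually (lt_mem_nhds (by linarith : f a - ε / 2 < f a)),
      (hlim b).eventually (gt_mem_nhds (by linarith : f b < f b + ε / 2))]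
      with n h1 h2 h3 h4 using ⟨h1, h2, h3, h4⟩
  obtain ⟨n, hnN, hlt, hna, hnb⟩ := hev.exists
  obtain ⟨x, hx, hxc, hxv⟩ : ∃ x ∈ uIoo a b, ContinuousAt (u n) x ∧ u n x ∈ Ioo (u n a) (u n b) := by
    rcases lt_trichotomy a b with h | rfl | h
    · obtain ⟨x, hx, hxc, hxv⟩ := hu n a b h hlt.ne
      rw [uIoo_of_lt hlt] at hxv
      rw [uIoo_of_lt h]
      exact ⟨x, hx, hxc, hxv⟩
    · exact absurd hlt (lt_irrefl _)
    · obtain ⟨x, hx, hxc, hxv⟩ := hu n b a h hlt.ne'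
      rw [uIoo_of_gt hlt] at hxv
      rw [uIoo_of_gt h]
      exact ⟨x, hx, hxc, hxv⟩
  have hopen : IsOpen (uIoo a b) := isOpen_Ioo
  have hnear : ∀ᶠ y in 𝓝 x, y ∈ uIoo a b ∧ u n y ∈ Ioo (u n a) (u n b) :=
    Filter.Eventually.and (hopen.mem_nhds hx) (hxc.eventually (isOpen_Ioo.mem_nhds hxv))
  obtain ⟨y, ⟨hy1, hy2⟩, hyB⟩ := mem_closure_iff_nhds.1 (hBd x) _ hnear
  have hylr : y ∈ Ioo l r :=
    ⟨(lt_min ha.1 hb.1).trans hy1.1, hy1.2.trans (max_lt ha.2 hb.2)⟩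
  have hd := abs_le.1 (hN n hnN y ⟨hyB, hylr⟩)
  refine ⟨y, ⟨hyB.1, hy1⟩, ?_, ?_⟩
  · linarith [hy2.1, hd.2]
  · linarith [hy2.2, hd.1]

/-! ### Schemes of disjoint intervals -/

/-- Take a maximal disjoint family: an open set missing its union would contain a further member. -/
theorem exists_pairwiseDisjoint_dense_sUnion {X : Type*} [TopologicalSpace X] {P : Set X → Prop}
    (hPo : ∀ J, P J → IsOpen J ∧ J.Nonempty)
    (hP : ∀ O : Set X, IsOpen O → O.Nonempty → ∃ J ⊆ O, P J) :
    ∃ C : Set (Set X), (∀ J ∈ C, P J) ∧ C.PairwiseDisjoint id ∧ Dense (⋃₀ C) := by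
  obtain ⟨C, hC⟩ := zorn_subset {C : Set (Set X) | (∀ J ∈ C, P J) ∧ C.PairwiseDisjoint id} (by
    intro c hc hchain
    refine ⟨⋃₀ c, ⟨?_, ?_⟩, fun s hs => subset_sUnion_of_mem hs⟩
    · rintro J ⟨s, hs, hJ⟩
      exact (hc hs).1 J hJ
    · exact (pairwiseDisjoint_sUnion hchain.directedOn).2 fun s hs => (hc hs).2)
  refine ⟨C, hC.prop.1, hC.prop.2, dense_iff_inter_open.2 fun O hO hne => ?_⟩
  by_contra hempty
  obtain ⟨J, hJO, hJ⟩ := hP O hO hne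
  have hdisj : ∀ K ∈ C, Disjoint J K := by
    intro K hK
    rw [Set.disjoint_left]
    exact fun x hx hxK => hempty ⟨x, hJO hx, K, hK, hxK⟩
  have hins : insert J C ⊆ C := hC.le_of_ge
    ⟨by
      rintro K (rfl | hK)
      · exact hJ
      · exact hC.prop.1 K hK,
     hC.prop.2.insert fun K hK _ => hdisj K hK⟩ (subset_insert J C)
  obtain ⟨x, hx⟩ := (hPo J hJ).2
  exact Set.disjoint_left.1 (hdisj J (hins (mem_insert _ _))) hx hx

/-- A sequence of families `C n` of pairwise disjoint open intervals with the property `P n`, whose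
unions are dense, decreasing, and have intersection contained in `G`. -/
structure IntervalScheme (G : Set ℝ) (P : ℕ → Set ℝ → Prop) (C : ℕ → Set (Set ℝ)) : Prop where
  eq_Ioo : ∀ n, ∀ J ∈ C n, ∃ a b, a < b ∧ J = Ioo a b
  prop : ∀ n, ∀ J ∈ C n, P n J
  pairwiseDisjoint : ∀ n, (C n).PairwiseDisjoint id
  dense : ∀ n, Dense (⋃₀ C n)
  succ_subset : ∀ n, ⋃₀ C (n + 1) ⊆ ⋃₀ C n
  iInter_subset : ⋂ n, ⋃₀ C n ⊆ G

/-- Choose dense open sets `V n` with intersection inside `G`; stage `n` is a maximal disjoint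
family of intervals inside the previous union and `V n`. -/
theorem exists_intervalScheme {G : Set ℝ} (hG : G ∈ residual ℝ) {P : ℕ → Set ℝ → Prop}
    (hP : ∀ n, ∀ O : Set ℝ, IsOpen O → O.Nonempty → ∃ a b, a < b ∧ Ioo a b ⊆ O ∧ P n (Ioo a b)) :
    ∃ C, IntervalScheme G P C := by
  obtain ⟨t, htG, htδ, htd⟩ := mem_residual.1 hG
  obtain ⟨V, hVo, rfl⟩ := htδ.eq_iInter_nat
  have hVd : ∀ n, Dense (V n) := fun n => htd.mono (iInter_subset _ n)
  have step : ∀ (n : ℕ) (D : {D : Set (Set ℝ) // IsOpen (⋃₀ D) ∧ Dense (⋃₀ D)}),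
      ∃ C : {D : Set (Set ℝ) // IsOpen (⋃₀ D) ∧ Dense (⋃₀ D)},
        (∀ J ∈ C.1, (∃ a b, a < b ∧ J = Ioo a b) ∧ P n J ∧ J ⊆ ⋃₀ D.1 ∩ V n) ∧
        C.1.PairwiseDisjoint id := by
    intro n D
    obtain ⟨C, hC, hCd, hCdense⟩ := exists_pairwiseDisjoint_dense_sUnion
      (P := fun J => (∃ a b, a < b ∧ J = Ioo a b) ∧ P n J ∧ J ⊆ ⋃₀ D.1 ∩ V n)
      (by
        rintro J ⟨⟨a, b, hab, rfl⟩, -⟩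
        exact ⟨isOpen_Ioo, nonempty_Ioo.2 hab⟩)
      (by
        intro O hO hne
        have hd : Dense (⋃₀ D.1 ∩ V n) := D.2.2.inter_of_isOpen_left (hVd n) D.2.1
        have hne' : (O ∩ (⋃₀ D.1 ∩ V n)).Nonempty := hd.inter_open_nonempty O hO hne
        obtain ⟨a, b, hab, hsub, hPab⟩ := hP n _ (hO.inter (D.2.1.inter (hVo n))) hne'
        exact ⟨Ioo a b, fun x hx => (hsub hx).1, ⟨a, b, hab, rfl⟩, hPab, fun x hx => (hsub hx).2⟩)
    refine ⟨⟨C, isOpen_sUnion fun J hJ => ?_, hCdense⟩, hC, hCd⟩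
    obtain ⟨⟨a, b, -, rfl⟩, -⟩ := hC J hJ
    exact isOpen_Ioo
  choose next hnext hdisj using step
  -- The recursion starts from the whole line, which is not part of the scheme: `C n` is `D (n +
  -- 1)`.
  let D : ℕ → {D : Set (Set ℝ) // IsOpen (⋃₀ D) ∧ Dense (⋃₀ D)} := fun n =>
    Nat.rec ⟨{univ}, by simp, by simp⟩ next n
  have hD : ∀ n, D (n + 1) = next n (D n) := fun n => rfl
  refine ⟨fun n => (D (n + 1)).1, ?_, ?_, ?_, fun n => (D (n + 1)).2.2, ?_, ?_⟩
  · exact fun n J hJ => (hnext n (D n) J hJ).1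
  · exact fun n J hJ => (hnext n (D n) J hJ).2.1
  · exact fun n => hdisj n (D n)
  · rintro n x ⟨J, hJ, hx⟩
    exact ((hnext (n + 1) (D (n + 1)) J hJ).2.2 hx).1
  · refine Subset.trans (fun x hx => mem_iInter.2 fun n => ?_) htG
    obtain ⟨J, hJ, hxJ⟩ := mem_iInter.1 hx n
    exact ((hnext n (D n) J hJ).2.2 hxJ).2

namespace IntervalScheme

variable {G : Set ℝ} {P : ℕ → Set ℝ → Prop} {C : ℕ → Set (Set ℝ)}

theorem isOpen (h : IntervalScheme G P C) {n : ℕ} {J : Set ℝ} (hJ : J ∈ C n) : IsOpen J := by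
  obtain ⟨a, b, -, rfl⟩ := h.eq_Ioo n J hJ
  exact isOpen_Ioo

theorem isOpen_sUnion (h : IntervalScheme G P C) (n : ℕ) : IsOpen (⋃₀ C n) :=
  _root_.isOpen_sUnion fun _ hJ => h.isOpen hJ

theorem antitone (h : IntervalScheme G P C) : Antitone fun n => ⋃₀ C n :=
  antitone_nat_of_succ_le h.succ_subset

theorem eq_of_mem (h : IntervalScheme G P C) {n : ℕ} {J K : Set ℝ} (hJ : J ∈ C n) (hK : K ∈ C n)
    {x : ℝ} (hxJ : x ∈ J) (hxK : x ∈ K) : J = K :=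
  (h.pairwiseDisjoint n).elim_set hJ hK x hxJ hxK

theorem subset_of_isPreconnected (h : IntervalScheme G P C) {n : ℕ} {J s : Set ℝ} (hJ : J ∈ C n)
    (hs : IsPreconnected s) (hsub : s ⊆ ⋃₀ C n) (hne : (s ∩ J).Nonempty) : s ⊆ J := by
  refine hs.subset_left_of_subset_union (v := ⋃₀ (C n \ {J})) (h.isOpen hJ)
    (_root_.isOpen_sUnion fun _ hK => h.isOpen hK.1) ?_ ?_ hne
  · rw [Set.disjoint_left]
    rintro x hx ⟨K, hK, hxK⟩
    exact hK.2 (h.eq_of_mem hK.1 hJ hxK hx)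
  · intro x hx
    obtain ⟨K, hK, hxK⟩ := hsub hx
    by_cases hKJ : K = J
    · exact Or.inl (hKJ ▸ hxK)
    · exact Or.inr ⟨K, ⟨hK, hKJ⟩, hxK⟩

/-- Functions given on the intervals of `C n` and off their union can be glued. -/
theorem exists_glue (h : IntervalScheme G P C) (f : ℝ → ℝ) (ψ : ℕ → Set ℝ → ℝ → ℝ) :
    ∃ u : ℕ → ℝ → ℝ, (∀ n, ∀ J ∈ C n, EqOn (u n) (ψ n J) J) ∧
      ∀ n, EqOn (u n) f (⋃₀ C n)ᶜ := by
  classical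
  refine ⟨fun n z => if hz : ∃ J ∈ C n, z ∈ J then ψ n hz.choose z else f z, ?_, ?_⟩
  · intro n J hJ z hz
    have hex : ∃ J ∈ C n, z ∈ J := ⟨J, hJ, hz⟩
    have : hex.choose = J :=
      h.eq_of_mem hex.choose_spec.1 hJ hex.choose_spec.2 hz
    simp only [dif_pos hex, this]
  · intro n z hz
    exact dif_neg fun ⟨J, hJ, hzJ⟩ => hz ⟨J, hJ, hzJ⟩

/-- Convergence criterion for glued functions. -/
theorem tendsto_of_eqOn_compl (h : IntervalScheme G P C) {f : ℝ → ℝ} {u : ℕ → ℝ → ℝ}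
    (hf : ∀ n, EqOn (u n) f (⋃₀ C n)ᶜ)
    (hu : ∀ x, (∀ n, x ∈ ⋃₀ C n) → Tendsto (fun n => u n x) atTop (𝓝 (f x))) (x : ℝ) :
    Tendsto (fun n => u n x) atTop (𝓝 (f x)) := by
  by_cases hx : ∀ n, x ∈ ⋃₀ C n
  · exact hu x hx
  · push Not at hx
    obtain ⟨M, hM⟩ := hx
    refine tendsto_const_nhds.congr' ?_
    filter_upwards [eventually_ge_atTop M] with n hn
    exact (hf n fun hxn => hM (h.antitone hn hxn)).symm

theorem mem_bairePropertyFunctions (h : IntervalScheme G P C) {g : ℝ → ℝ} {n : ℕ}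
    (hg : ∀ J ∈ C n, ContinuousOn g J) : g ∈ bairePropertyFunctions := by
  refine mem_bairePropertyFunctions_iff.2
    ⟨⋃₀ C n, residual_of_dense_open (h.isOpen_sUnion n) (h.dense n), ?_⟩
  rintro x ⟨J, hJ, hx⟩
  exact ((hg J hJ).continuousAt ((h.isOpen hJ).mem_nhds hx)).continuousWithinAt

/-- Where `g` is constant, `CondSOn` is vacuous. -/
theorem mem_frakS (h : IntervalScheme G P C) {g : ℝ → ℝ} {n : ℕ}
    (hg : ∀ J ∈ C n, ∃ c, ∀ x ∈ J, g x = c) : g ∈ frakS := by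
  refine ⟨h.mem_bairePropertyFunctions (n := n) fun J hJ => ?_, fun A _ ε _ => ?_⟩
  · obtain ⟨c, hc⟩ := hg J hJ
    exact continuousOn_const.congr hc
  · refine (h.dense n).mono (sUnion_subset_sUnion fun J hJ => ?_)
    obtain ⟨c, hc⟩ := hg J hJ
    refine ⟨h.isOpen hJ, ?_, fun a ha b hb hab => ?_⟩
    · obtain ⟨a, b, -, rfl⟩ := h.eq_Ioo n J hJ
      exact ordConnected_Ioo
    · rw [hc a ha, hc b hb] at hab
      exact absurd hab (lt_irrefl _)

end IntervalScheme

/-! ### Approximation from `frakS` -/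

theorem exists_Ioo_abs_sub_le {f : ℝ → ℝ} {G : Set ℝ} (hG : Dense G) (hf : ContinuousOn f G)
    {ε : ℝ} (hε : 0 < ε) {O : Set ℝ} (hO : IsOpen O) (hne : O.Nonempty) :
    ∃ a b, a < b ∧ Ioo a b ⊆ O ∧ (∀ x ∈ Ioo a b, ∀ y ∈ Ioo a b, |x - y| ≤ ε) ∧
      ∀ x ∈ G ∩ Ioo a b, ∀ y ∈ G ∩ Ioo a b, |f x - f y| ≤ ε := by
  obtain ⟨g, hgO, hgG⟩ := hG.inter_open_nonempty O hO hne
  have h1 : ∀ᶠ x in 𝓝 g, x ∈ G → |f x - f g| < ε / 2 :=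
    eventually_nhdsWithin_iff.1 ((hf g hgG).eventually (Metric.ball_mem_nhds (f g) (half_pos hε)))
  have h2 : ∀ᶠ x in 𝓝 g, |x - g| < ε / 2 := Metric.ball_mem_nhds g (half_pos hε)
  have h3 : ∀ᶠ x in 𝓝 g, x ∈ O := hO.mem_nhds hgO
  obtain ⟨a, b, hg, hab⟩ := mem_nhds_iff_exists_Ioo_subset.1 (h1.and (h2.and h3))
  refine ⟨a, b, hg.1.trans hg.2, fun x hx => (hab hx).2.2, fun x hx y hy => ?_,
    fun x hx y hy => ?_⟩
  · have hx' := abs_lt.1 (hab hx).2.1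
    have hy' := abs_lt.1 (hab hy).2.1
    exact abs_le.2 ⟨by linarith [hx'.1, hy'.2], by linarith [hx'.2, hy'.1]⟩
  · have hx' := abs_lt.1 ((hab hx.2).1 hx.1)
    have hy' := abs_lt.1 ((hab hy.2).1 hy.1)
    exact abs_le.2 ⟨by linarith [hx'.1, hy'.2], by linarith [hx'.2, hy'.1]⟩

/-- Replace `f` on each `J` in `C n` by its value at a point of `G ∩ J`. Points in all the unions
lie in `G`, where the oscillation bound gives convergence; elsewhere the sequence is eventually `f`.
-/
theorem bairePropertyFunctions_subset_LIM_frakS : bairePropertyFunctions ⊆ LIM frakS := by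
  intro f hf
  obtain ⟨G, hG, hfG⟩ := mem_bairePropertyFunctions_iff.1 hf
  have hGd := dense_of_mem_residual hG
  obtain ⟨C, hC⟩ := exists_intervalScheme hG
    (P := fun n J => ∀ x ∈ G ∩ J, ∀ y ∈ G ∩ J, |f x - f y| ≤ 1 / ((n : ℝ) + 1))
    (fun n O hO hne => by
      obtain ⟨a, b, hab, hsub, -, h⟩ :=
        exists_Ioo_abs_sub_le hGd hfG (Nat.one_div_pos_of_nat (n := n)) hO hne
      exact ⟨a, b, hab, hsub, h⟩)
  have hcex : ∀ n, ∀ J ∈ C n, ∃ g, g ∈ G ∩ J := by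
    intro n J hJ
    obtain ⟨a, b, hab, rfl⟩ := hC.eq_Ioo n J hJ
    obtain ⟨g, hg1, hg2⟩ := hGd.inter_open_nonempty _ isOpen_Ioo (nonempty_Ioo.2 hab)
    exact ⟨g, hg2, hg1⟩
  choose! g hg using hcex
  obtain ⟨u, huJ, huf⟩ := hC.exists_glue f fun n J _ => f (g n J)
  refine ⟨u, fun n => hC.mem_frakS (n := n) fun J hJ => ⟨_, huJ n J hJ⟩,
    hC.tendsto_of_eqOn_compl huf fun x hx => ?_⟩
  have hxG : x ∈ G := hC.iInter_subset (mem_iInter.2 hx)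
  refine tendsto_iff_dist_tendsto_zero.2 (squeeze_zero (fun _ => dist_nonneg) (fun n => ?_)
    tendsto_one_div_add_atTop_nhds_zero_nat)
  obtain ⟨J, hJ, hxJ⟩ := hx n
  rw [huJ n J hJ hxJ, Real.dist_eq]
  exact hC.prop n J hJ _ (hg n J hJ) x ⟨hxG, hxJ⟩

/-! ### Oscillating functions with prescribed range -/

theorem IsPreconnected.exists_mul_sin_eq {s : Set ℝ} (hs : IsPreconnected s) {v : ℝ → ℝ}
    (hv : ContinuousOn v s) (hunb : ∀ M, ∃ z ∈ s, M < v z) (y : ℝ) :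
    ∃ z ∈ s, v z * Real.sin (v z) = y := by
  obtain ⟨z₀, hz₀, -⟩ := hunb 0
  have hIci : ∀ t, v z₀ ≤ t → ∃ z ∈ s, v z = t := by
    intro t ht
    obtain ⟨z₁, hz₁, hlt⟩ := hunb t
    exact hs.intermediate_value hz₀ hz₁ hv ⟨ht, hlt.le⟩
  obtain ⟨k, hk⟩ := exists_nat_ge (max |y| (v z₀))
  have hk1 := (le_max_left _ _).trans hk
  have hk2 := (le_max_right _ _).trans hk
  have hπ := Real.pi_gt_three
  have hk0 : (0 : ℝ) ≤ k := k.cast_nonneg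
  have hkπ : (k : ℝ) ≤ k * (2 * Real.pi) := by nlinarith
  obtain ⟨z₁, hz₁, h1⟩ := hIci (Real.pi / 2 + k * (2 * Real.pi)) (by linarith)
  -- The shift to `k + 1` keeps this argument above `v z₀`; the product is at most `-|y|` here and
  -- at least `|y|` at `z₁`.
  obtain ⟨z₂, hz₂, h2⟩ := hIci (-(Real.pi / 2) + (k + 1 : ℕ) * (2 * Real.pi)) (by
    push_cast; linarith)
  have hy := abs_le.1 hk1
  refine hs.intermediate_value hz₂ hz₁ (hv.mul (Real.continuous_sin.comp_continuousOn hv)) ⟨?_, ?_⟩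
  · rw [Pi.mul_apply, Function.comp_apply, h2, Real.sin_add_nat_mul_two_pi, Real.sin_neg, Real.sin_pi_div_two]
    push_cast
    linarith [hy.1]
  · rw [Pi.mul_apply, Function.comp_apply, h1, Real.sin_add_nat_mul_two_pi, Real.sin_pi_div_two]
    linarith [hy.2]

/-- There is a continuous function on `(a, b)` attaining every value near each end-point. -/
theorem exists_continuousOn_Ioo_surjective_near_ends (a b : ℝ) :
    ∃ φ : ℝ → ℝ, ContinuousOn φ (Ioo a b) ∧ ∀ x ∈ Ioo a b, ∀ y,
      (∃ z ∈ Ioo a x, φ z = y) ∧ ∃ z ∈ Ioo x b, φ z = y := by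
  -- This `v` tends to infinity at both ends of the interval.
  set v : ℝ → ℝ := fun z => (z - a)⁻¹ + (b - z)⁻¹ with hvdef
  have hv : ContinuousOn v (Ioo a b) := by
    refine ContinuousOn.add (ContinuousOn.inv₀ (by fun_prop) fun z hz => ?_)
      (ContinuousOn.inv₀ (by fun_prop) fun z hz => ?_)
    · exact (sub_pos.2 hz.1).ne'
    · exact (sub_pos.2 hz.2).ne'
  have hδ : ∀ l : ℝ, 0 < l → ∀ M : ℝ, ∃ δ, 0 < δ ∧ δ < l ∧ M < δ⁻¹ := by
    intro l hl M
    refine ⟨min (l / 2) (|M| + 1)⁻¹, by positivity, (min_le_left _ _).trans_lt (by linarith), ?_⟩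
    have h1 : |M| + 1 ≤ (min (l / 2) (|M| + 1)⁻¹)⁻¹ :=
      le_inv_of_le_inv₀ (by positivity) (min_le_right _ _)
    linarith [le_abs_self M]
  refine ⟨fun z => v z * Real.sin (v z), hv.mul (Real.continuous_sin.comp_continuousOn hv),
    fun x hx y => ⟨?_, ?_⟩⟩
  · refine isPreconnected_Ioo.exists_mul_sin_eq (hv.mono (Ioo_subset_Ioo_right hx.2.le))
      (fun M => ?_) y
    obtain ⟨δ, h0, hl, hM⟩ := hδ (x - a) (sub_pos.2 hx.1) M
    refine ⟨a + δ, ⟨by linarith, by linarith⟩, ?_⟩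
    have : 0 < (b - (a + δ))⁻¹ := inv_pos.2 (by linarith [hx.2])
    simp only [hvdef, add_sub_cancel_left]
    linarith
  · refine isPreconnected_Ioo.exists_mul_sin_eq (hv.mono (Ioo_subset_Ioo_left hx.1.le))
      (fun M => ?_) y
    obtain ⟨δ, h0, hl, hM⟩ := hδ (b - x) (sub_pos.2 hx.2) M
    refine ⟨b - δ, ⟨by linarith, by linarith⟩, ?_⟩
    have : 0 < (b - δ - a)⁻¹ := inv_pos.2 (by linarith [hx.1])
    simp only [hvdef, sub_sub_cancel]
    linarith

theorem exists_continuous_range_eq_ball (c : ℝ) {R : ℝ} (hR : 0 < R) :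
    ∃ h : ℝ → ℝ, Continuous h ∧ range h = Metric.ball c R := by
  refine ⟨OpenPartialHomeomorph.univBall c R, OpenPartialHomeomorph.continuous_univBall c R, ?_⟩
  rw [← image_univ, ← OpenPartialHomeomorph.univBall_source c R,
    OpenPartialHomeomorph.image_source_eq_target, OpenPartialHomeomorph.univBall_target c hR]

/-- A continuous function on `ℝ` with range an open interval around `c`, of radius prescribed
by the largest `j ≤ n` with `p j`, and equal to `ℝ` if there is no such `j`. -/
theorem exists_continuous_range_of_antitone (c : ℝ) {p : ℕ → Prop} (hp : Antitone p) (n : ℕ) :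
    ∃ h : ℝ → ℝ, Continuous h ∧ IsOpen (range h) ∧
      (∀ M ≤ n, p M → range h ⊆ Metric.ball c (3 / ((M : ℝ) + 1))) ∧
      (¬ p 0 → range h = univ) ∧
      ∀ j, j + 1 ≤ n → ¬ p (j + 1) → Metric.ball c (3 / ((j : ℝ) + 1)) ⊆ range h := by
  classical
  have hrad : ∀ {i j : ℕ}, i ≤ j →
      Metric.ball c (3 / ((j : ℝ) + 1)) ⊆ Metric.ball c (3 / ((i : ℝ) + 1)) := by
    intro i j hij
    exact Metric.ball_subset_ball (by gcongr)
  by_cases h0 : p 0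
  · set k := Nat.findGreatest p n with hk
    obtain ⟨h, hc, hr⟩ := exists_continuous_range_eq_ball c (R := 3 / ((k : ℝ) + 1)) (by positivity)
    refine ⟨h, hc, hr ▸ Metric.isOpen_ball, fun M hM hpM => ?_, fun hn => absurd h0 hn,
      fun j _ hj => ?_⟩
    · exact hr ▸ hrad (Nat.le_findGreatest hM hpM)
    · rw [hr]
      refine hrad ?_
      have hpk : p k := Nat.findGreatest_spec (Nat.zero_le n) h0
      by_contra! hlt
      exact hj (hp (Nat.succ_le_of_lt hlt) hpk)
  · refine ⟨id, continuous_id, by simp, fun M _ hpM => absurd (hp (Nat.zero_le M) hpM) h0,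
      by simp, by simp⟩

/-- The source of the radius `3 / (j + 1)`: the centre will be within `2 * ε` of the target
interval, and the third `ε` lets the ball enter it. -/
theorem exists_mem_ball_inter_Ioo {c α β ε : ℝ} (hε : 0 < ε) (hαβ : α < β) (h1 : α - 2 * ε < c)
    (h2 : c < β + 2 * ε) : ∃ y ∈ Metric.ball c (3 * ε), y ∈ Ioo α β := by
  obtain ⟨y, hy1, hy2⟩ := exists_between (show max α (c - 3 * ε) < min β (c + 3 * ε) from
    max_lt (lt_min hαβ (by linarith)) (lt_min (by linarith) (by linarith)))
  have ha := max_lt_iff.1 hy1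
  have hb := lt_min_iff.1 hy2
  refine ⟨y, ?_, ha.1, hb.1⟩
  rw [Real.ball_eq_Ioo]
  exact ⟨ha.2, hb.2⟩

/-! ### Approximation of `frakS` by Świątkowski functions -/

theorem exists_Ioo_condSOn {f : ℝ → ℝ} {G : Set ℝ} (hG : Dense G) (hfG : ContinuousOn f G)
    {ε : ℝ} (hε : 0 < ε) (hf : CondS f G ε) {O : Set ℝ} (hO : IsOpen O) (hne : O.Nonempty) :
    ∃ a b, a < b ∧ Ioo a b ⊆ O ∧ (∀ x ∈ Ioo a b, ∀ y ∈ Ioo a b, |x - y| ≤ ε) ∧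
      (∀ x ∈ G ∩ Ioo a b, ∀ y ∈ G ∩ Ioo a b, |f x - f y| ≤ ε) ∧ CondSOn f (Ioo a b) G ε := by
  obtain ⟨x, hxO, J, ⟨hJo, -, hJ⟩, hxJ⟩ := hf.inter_open_nonempty O hO hne
  obtain ⟨a, b, hab, hsub, hd, ho⟩ :=
    exists_Ioo_abs_sub_le hG hfG hε (hO.inter hJo) ⟨x, hxO, hxJ⟩
  exact ⟨a, b, hab, fun y hy => (hsub hy).1, hd, ho,
    fun s hs t ht hst => hJ s (hsub hs).2 t (hsub ht).2 hst⟩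

/-- A function glued from wildly oscillating continuous functions on the intervals of `C n` and a
function in `𝔖` off these intervals is a Świątkowski function. Here `K J` is the set of values
attained near each end-point of `J`, and `c J` is the centre of `K J`. -/
theorem IntervalScheme.mem_swiatkowskiFunctions {f : ℝ → ℝ} {G : Set ℝ} {P : ℕ → Set ℝ → Prop}
    {C : ℕ → Set (Set ℝ)} (hC : IntervalScheme G P C)
    (hP : ∀ n J, P n J → (∀ x ∈ G ∩ J, ∀ y ∈ G ∩ J, |f x - f y| ≤ 1 / ((n : ℝ) + 1)) ∧
      CondSOn f J G (1 / ((n : ℝ) + 1)))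
    {n : ℕ} {u : ℝ → ℝ} (huf : EqOn u f (⋃₀ C n)ᶜ) {K : Set ℝ → Set ℝ} {g : Set ℝ → ℝ}
    (hg : ∀ J ∈ C n, g J ∈ G ∩ J)
    (huc : ∀ J ∈ C n, ContinuousOn u J) (huK : ∀ J ∈ C n, MapsTo u J (K J))
    (hKo : ∀ J ∈ C n, IsOpen (K J))
    (huends : ∀ J ∈ C n, ∀ a b, J = Ioo a b → ∀ x ∈ J, ∀ y ∈ K J,
      (∃ z ∈ Ioo a x, u z = y) ∧ ∃ z ∈ Ioo x b, u z = y)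
    (hK0 : ∀ J ∈ C n, (∃ w ∈ J, ∃ x ∉ ⋃₀ C 0, |w - x| < 1 / ((n : ℝ) + 1)) → K J = univ)
    (hKs : ∀ J ∈ C n, ∀ j, j + 1 ≤ n →
      (∃ w ∈ J, ∃ x ∉ ⋃₀ C (j + 1), |w - x| < 1 / ((n : ℝ) + 1)) →
      Metric.ball (f (g J)) (3 / ((j : ℝ) + 1)) ⊆ K J) :
    u ∈ swiatkowskiFunctions := by
  intro p q hpq hne
  have hcont : ∀ J ∈ C n, ∀ x ∈ J, ContinuousAt u x := fun J hJ x hx =>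
    (huc J hJ).continuousAt ((hC.isOpen hJ).mem_nhds hx)
  have hlt : min (u p) (u q) < max (u p) (u q) := min_lt_max.2 hne
  -- values in `K J` are attained in `(p, q)` if `J` has an end-point there
  have attain : ∀ J ∈ C n, ∀ x z, x ∉ J → z ∈ J → x ∈ Icc p q → z ∈ Icc p q → ∀ y ∈ K J,
      y ∈ uIoo (u p) (u q) → ∃ x ∈ Ioo p q, ContinuousAt u x ∧ u x ∈ uIoo (u p) (u q) := by
    intro J hJ x z hxJ hzJ hx hz y hyK hy
    obtain ⟨a, b, hab, hJab⟩ := hC.eq_Ioo n J hJ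
    have hz' := hJab ▸ hzJ
    have ends := huends J hJ a b hJab z hzJ y hyK
    rcases lt_or_ge x z with hxz | hzx
    · have hxa : x ≤ a := by
        by_contra! h
        exact hxJ (hJab ▸ ⟨h, hxz.trans hz'.2⟩)
      obtain ⟨w, hw, rfl⟩ := ends.1
      exact ⟨w, ⟨(hx.1.trans hxa).trans_lt hw.1, hw.2.trans_le hz.2⟩,
        hcont J hJ w (hJab ▸ ⟨hw.1, hw.2.trans hz'.2⟩), hy⟩
    · have hxb : b ≤ x := by
        by_contra! h
        exact hxJ (hJab ▸ ⟨hz'.1.trans_le hzx, h⟩)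
      obtain ⟨w, hw, rfl⟩ := ends.2
      exact ⟨w, ⟨hz.1.trans_lt hw.1, (hw.2.trans_le hxb).trans_le hx.2⟩,
        hcont J hJ w (hJab ▸ ⟨hz'.1.trans hw.1, hw.2⟩), hy⟩
  -- If `[p, q]` is covered, connectedness puts it in a single `J`, where the intermediate value
  -- theorem applies.
  by_cases hsub : Icc p q ⊆ ⋃₀ C n
  · obtain ⟨J, hJ, hpJ⟩ := hsub (left_mem_Icc.2 hpq.le)
    have hJsub : Icc p q ⊆ J := hC.subset_of_isPreconnected hJ isPreconnected_Icc hsub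
      ⟨p, left_mem_Icc.2 hpq.le, hpJ⟩
    obtain ⟨y, hy⟩ := exists_between hlt
    have hivt : y ∈ u '' Icc p q := by
      have huc' := (huc J hJ).mono hJsub
      rw [← uIcc_of_le hpq.le] at huc' ⊢
      exact intermediate_value_uIcc huc' ⟨hy.1.le, hy.2.le⟩
    obtain ⟨x, hx, rfl⟩ := hivt
    have hxp : x ≠ p := by
      rintro rfl
      rcases min_lt_iff.1 hy.1 with h | h <;> rcases lt_max_iff.1 hy.2 with h' | h' <;>
        first | exact (lt_irrefl _ h).elim | exact (lt_irrefl _ h').elim | exact (h.not_gt h').elim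
    have hxq : x ≠ q := by
      rintro rfl
      rcases min_lt_iff.1 hy.1 with h | h <;> rcases lt_max_iff.1 hy.2 with h' | h' <;>
        first | exact (lt_irrefl _ h).elim | exact (lt_irrefl _ h').elim | exact (h.not_gt h').elim
    exact ⟨x, ⟨lt_of_le_of_ne hx.1 hxp.symm, lt_of_le_of_ne hx.2 hxq⟩, hcont J hJ x (hJsub hx), hy⟩
  obtain ⟨x₀, hx₀, hx₀n⟩ := not_subset.1 hsub
  -- an end-point in some `J` forces nearby values in the open set `K J`
  have inner : ∀ r ∈ Icc p q, (u r = u p ∨ u r = u q) → r ∈ ⋃₀ C n →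
      ∃ x ∈ Ioo p q, ContinuousAt u x ∧ u x ∈ uIoo (u p) (u q) := by
    rintro r hr hrv ⟨J, hJ, hrJ⟩
    have hnhds : K J ∈ 𝓝 (u r) := (hKo J hJ).mem_nhds (huK J hJ hrJ)
    have hcl : u r ∈ closure (uIoo (u p) (u q)) := by
      rw [uIoo, closure_Ioo hlt.ne]
      rcases hrv with h | h <;> rw [h]
      · exact ⟨min_le_left _ _, le_max_left _ _⟩
      · exact ⟨min_le_right _ _, le_max_right _ _⟩
    obtain ⟨y, hyK, hy⟩ := mem_closure_iff_nhds.1 hcl _ hnhds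
    exact attain J hJ x₀ r (fun h => hx₀n ⟨J, hJ, h⟩) hrJ hx₀ hr y hyK hy
  by_cases hpn : p ∈ ⋃₀ C n
  · exact inner p (left_mem_Icc.2 hpq.le) (Or.inl rfl) hpn
  by_cases hqn : q ∈ ⋃₀ C n
  · exact inner q (right_mem_Icc.2 hpq.le) (Or.inr rfl) hqn
  classical
  -- Both end-points now lie off `⋃₀ C n`, where `u = f`. The least `k` with `[p, q]` not covered by
  -- `C k` fixes the scale: for `k = j + 1` a single interval of `C j` contains `[p, q]`.
  have hex : ∃ k, ∃ x ∈ Icc p q, x ∉ ⋃₀ C k := ⟨n, x₀, hx₀, hx₀n⟩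
  obtain ⟨x, hx, hxk⟩ := Nat.find_spec hex
  have hkn : Nat.find hex ≤ n := Nat.find_min' hex ⟨x₀, hx₀, hx₀n⟩
  have hmin : ∀ j < Nat.find hex, Icc p q ⊆ ⋃₀ C j := by
    intro j hj y hy
    by_contra hyj
    exact Nat.find_min hex hj ⟨y, hy, hyj⟩
  generalize Nat.find hex = k at hxk hkn hmin
  -- an interval of `C n` near `x`
  obtain ⟨z, ⟨hzx, hz⟩, J, hJ, hzJ⟩ :
      (Metric.ball x (1 / ((n : ℝ) + 1)) ∩ Ioo p q ∩ ⋃₀ C n).Nonempty := by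
    refine (hC.dense n).inter_open_nonempty _ (Metric.isOpen_ball.inter isOpen_Ioo) ?_
    have : x ∈ closure (Ioo p q) := by rwa [closure_Ioo hpq.ne]
    exact mem_closure_iff_nhds.1 this _ (Metric.ball_mem_nhds x Nat.one_div_pos_of_nat)
  have hxJ : x ∉ J := fun h => hxk (hC.antitone hkn ⟨J, hJ, h⟩)
  have hzx' : |z - x| < 1 / ((n : ℝ) + 1) := hzx
  suffices h : ∃ y ∈ K J, y ∈ uIoo (u p) (u q) by
    obtain ⟨y, hyK, hy⟩ := h
    exact attain J hJ x z hxJ hzJ hx (Ioo_subset_Icc_self hz) y hyK hy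
  cases k with
  | zero =>
    obtain ⟨y, hy⟩ := exists_between hlt
    exact ⟨y, hK0 J hJ ⟨z, hzJ, x, hxk, hzx'⟩ ▸ mem_univ y, hy⟩
  | succ j =>
    have hKJ := hKs J hJ j hkn ⟨z, hzJ, x, hxk, hzx'⟩
    have hsubj := hmin j j.lt_succ_self
    obtain ⟨J', hJ', hpJ'⟩ := hsubj (left_mem_Icc.2 hpq.le)
    have hIccJ' : Icc p q ⊆ J' := hC.subset_of_isPreconnected hJ' isPreconnected_Icc hsubj
      ⟨p, left_mem_Icc.2 hpq.le, hpJ'⟩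
    have hJJ' : J ⊆ J' := by
      refine hC.subset_of_isPreconnected hJ' ?_ ?_ ⟨z, hzJ, hIccJ' (Ioo_subset_Icc_self hz)⟩
      · obtain ⟨a, b, -, rfl⟩ := hC.eq_Ioo n J hJ
        exact isPreconnected_Ioo
      · exact (subset_sUnion_of_mem hJ).trans (hC.antitone (Nat.le_of_succ_le hkn))
    obtain ⟨hosc, hS⟩ := hP j J' (hC.prop j J' hJ')
    set ε : ℝ := 1 / ((j : ℝ) + 1) with hε
    have hεpos : 0 < ε := Nat.one_div_pos_of_nat
    have hup : u p = f p := huf hpn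
    have huq : u q = f q := huf hqn
    have hqJ' := hIccJ' (right_mem_Icc.2 hpq.le)
    obtain ⟨w, hwG, hwpq, hw⟩ : ∃ w, w ∈ G ∧ w ∈ Ioo p q ∧
        f w ∈ Ioo (min (u p) (u q) - ε) (max (u p) (u q) + ε) := by
      rw [hup, huq] at hne ⊢
      rcases lt_or_gt_of_ne hne with h | h
      · obtain ⟨w, ⟨hw1, hw2⟩, hw3⟩ := hS p hpJ' q hqJ' h
        rw [uIoo_of_lt hpq] at hw2
        rw [min_eq_left h.le, max_eq_right h.le]
        exact ⟨w, hw1, hw2, hw3⟩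
      · obtain ⟨w, ⟨hw1, hw2⟩, hw3⟩ := hS q hqJ' p hpJ' h
        rw [uIoo_of_gt hpq] at hw2
        rw [min_eq_right h.le, max_eq_left h.le]
        exact ⟨w, hw1, hw2, hw3⟩
    -- The centre `f (g J)` is within `ε` of `f w`, and `f w` exceeds the target interval by less
    -- than `ε`.
    have hclose := abs_le.1 (hosc (g J) ⟨(hg J hJ).1, hJJ' (hg J hJ).2⟩ w
      ⟨hwG, hIccJ' (Ioo_subset_Icc_self hwpq)⟩)
    obtain ⟨y, hy1, hy2⟩ := exists_mem_ball_inter_Ioo (c := f (g J)) hεpos hlt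
      (by linarith [hw.1, hclose.1]) (by linarith [hw.2, hclose.2])
    refine ⟨y, hKJ ?_, hy2⟩
    rwa [hε, mul_one_div] at hy1

theorem frakS_subset_LIM_swiatkowskiFunctions : frakS ⊆ LIM swiatkowskiFunctions := by
  rintro f ⟨hfB, hfS⟩
  obtain ⟨G, hG, hfG⟩ := mem_bairePropertyFunctions_iff.1 hfB
  have hGd := dense_of_mem_residual hG
  obtain ⟨C, hC⟩ := exists_intervalScheme hG
    (P := fun n J => (∀ x ∈ J, ∀ y ∈ J, |x - y| ≤ 1 / ((n : ℝ) + 1)) ∧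
      (∀ x ∈ G ∩ J, ∀ y ∈ G ∩ J, |f x - f y| ≤ 1 / ((n : ℝ) + 1)) ∧
      CondSOn f J G (1 / ((n : ℝ) + 1)))
    (fun n O hO hne => exists_Ioo_condSOn hGd hfG Nat.one_div_pos_of_nat
      (hfS G hG _ Nat.one_div_pos_of_nat) hO hne)
  -- The antitone predicate that selects the radius says that `J` stays at distance at least `1 / (n
  -- + 1)` from the complement of `⋃₀ C M`.
  have hdata : ∀ n, ∀ J ∈ C n, ∃ (g : ℝ) (h φ : ℝ → ℝ), g ∈ G ∩ J ∧
      (Continuous h ∧ IsOpen (range h) ∧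
        (∀ M ≤ n, (∀ w ∈ J, ∀ x ∉ ⋃₀ C M, 1 / ((n : ℝ) + 1) ≤ |w - x|) →
          range h ⊆ Metric.ball (f g) (3 / ((M : ℝ) + 1))) ∧
        ((¬ ∀ w ∈ J, ∀ x ∉ ⋃₀ C 0, 1 / ((n : ℝ) + 1) ≤ |w - x|) → range h = univ) ∧
        ∀ j, j + 1 ≤ n → (¬ ∀ w ∈ J, ∀ x ∉ ⋃₀ C (j + 1), 1 / ((n : ℝ) + 1) ≤ |w - x|) →
          Metric.ball (f g) (3 / ((j : ℝ) + 1)) ⊆ range h) ∧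
      ContinuousOn φ J ∧ ∀ a b, J = Ioo a b → ∀ x ∈ J, ∀ y,
        (∃ z ∈ Ioo a x, φ z = y) ∧ ∃ z ∈ Ioo x b, φ z = y := by
    intro n J hJ
    obtain ⟨a, b, hab, rfl⟩ := hC.eq_Ioo n J hJ
    obtain ⟨g, hg1, hg2⟩ := hGd.inter_open_nonempty _ isOpen_Ioo (nonempty_Ioo.2 hab)
    obtain ⟨φ, hφ, hφe⟩ := exists_continuousOn_Ioo_surjective_near_ends a b
    obtain ⟨h, hh⟩ := exists_continuous_range_of_antitone (f g)
      (p := fun M => ∀ w ∈ Ioo a b, ∀ x ∉ ⋃₀ C M, 1 / ((n : ℝ) + 1) ≤ |w - x|)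
      (fun i j hij hp w hw x hx => hp w hw x fun hxj => hx (hC.antitone hij hxj)) n
    refine ⟨g, h, φ, ⟨hg2, hg1⟩, hh, hφ, fun a' b' hab' => ?_⟩
    have hab'' : a' < b' := nonempty_Ioo.1 (hab' ▸ ⟨g, hg1⟩)
    obtain rfl : a = a' := by rw [← csInf_Ioo hab, hab', csInf_Ioo hab'']
    obtain rfl : b = b' := by rw [← csSup_Ioo hab, hab', csSup_Ioo hab'']
    exact hφe
  choose! g h φ hg hh hφ hφe using hdata
  obtain ⟨u, huJ, huf⟩ := hC.exists_glue f fun n J => h n J ∘ φ n J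
  refine ⟨u, fun n => ?_, hC.tendsto_of_eqOn_compl huf fun x hx => ?_⟩
  · refine hC.mem_swiatkowskiFunctions (n := n) (fun n J hJ => hJ.2) (huf n)
      (K := fun J => range (h n J)) (g := g n) (hg n) (fun J hJ => ?_) (fun J hJ x hx => ?_)
      (fun J hJ => (hh n J hJ).2.1) ?_ (fun J hJ hfar => ?_) fun J hJ j hj hfar => ?_
    · exact ((hh n J hJ).1.comp_continuousOn (hφ n J hJ)).congr (huJ n J hJ)
    · rw [huJ n J hJ hx]
      exact mem_range_self _
    · rintro J hJ a b hab x hx _ ⟨t, rfl⟩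
      have hx' := hab ▸ hx
      obtain ⟨⟨z, hz, hzt⟩, w, hw, hwt⟩ := hφe n J hJ a b hab x hx t
      refine ⟨⟨z, hz, ?_⟩, w, hw, ?_⟩
      · rw [huJ n J hJ (hab ▸ ⟨hz.1, hz.2.trans hx'.2⟩), Function.comp_apply, hzt]
      · rw [huJ n J hJ (hab ▸ ⟨hx'.1.trans hw.1, hw.2⟩), Function.comp_apply, hwt]
    · refine (hh n J hJ).2.2.2.1 ?_
      push Not
      exact hfar
    · refine (hh n J hJ).2.2.2.2 j hj ?_
      push Not
      exact hfar
  · have hxG : x ∈ G := hC.iInter_subset (mem_iInter.2 hx)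
    rw [Metric.tendsto_atTop]
    intro η hη
    -- The error is at most `3 / (M + 1)` from the range plus `1 / (n + 1)` from the oscillation of
    -- `f` on `G ∩ J`.
    obtain ⟨M, hM⟩ := exists_nat_one_div_lt (show (0 : ℝ) < η / 4 by linarith)
    obtain ⟨δ, hδ, hball⟩ := Metric.isOpen_iff.1 (hC.isOpen_sUnion M) x (hx M)
    obtain ⟨N, hN⟩ := exists_nat_one_div_lt (half_pos hδ)
    refine ⟨max M N, fun n hn => ?_⟩
    have hMn := (le_max_left _ _).trans hn
    have hnN : 1 / ((n : ℝ) + 1) < δ / 2 :=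
      (Nat.one_div_le_one_div ((le_max_right _ _).trans hn)).trans_lt hN
    have hnM : 1 / ((n : ℝ) + 1) ≤ 1 / ((M : ℝ) + 1) := Nat.one_div_le_one_div hMn
    obtain ⟨J, hJ, hxJ⟩ := hx n
    obtain ⟨hdiam, hosc, -⟩ := hC.prop n J hJ
    -- The complement of `⋃₀ C M` is at least `δ` from `x`, and `J` lies within `1 / (n + 1) < δ /
    -- 2` of `x`, so `J` is far enough from that complement.
    have hrange := (hh n J hJ).2.2.1 M hMn (by
      intro w hw y hy
      have h1 : δ ≤ |y - x| := by
        by_contra! hlt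
        exact hy (hball hlt)
      have h2 := hdiam x hxJ w hw
      have h3 : |y - x| ≤ |w - y| + |x - w| := by
        rw [abs_sub_comm w y, abs_sub_comm x w]
        exact abs_sub_le y w x
      linarith)
    have hux : u n x ∈ Metric.ball (f (g n J)) (3 / ((M : ℝ) + 1)) := by
      rw [huJ n J hJ hxJ]
      exact hrange (mem_range_self _)
    have hux' : dist (u n x) (f (g n J)) < 3 * (1 / ((M : ℝ) + 1)) := by
      rw [mul_one_div]
      exact hux
    have hgx : dist (f (g n J)) (f x) ≤ 1 / ((n : ℝ) + 1) :=
      hosc _ (hg n J hJ) x ⟨hxG, hxJ⟩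
    linarith [dist_triangle (u n x) (f (g n J)) (f x)]

/-! ### Separating examples -/

/-- A strict increase forces `b = 0`, and any nonzero point of `A` in between has the value `f a =
0`. -/
theorem indicator_singleton_mem_frakS : (({0} : Set ℝ).indicator 1 : ℝ → ℝ) ∈ frakS := by
  refine ⟨fun U hU => MeasurableSet.baireMeasurableSet
    ((measurable_one.indicator (measurableSet_singleton 0)) hU.measurableSet), ?_⟩
  intro A hA ε hε
  refine dense_univ.mono (subset_sUnion_of_mem ⟨isOpen_univ, ordConnected_univ, ?_⟩)
  intro a _ b _ hab
  have hb : b = 0 := by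
    by_contra hb
    rw [indicator_of_notMem (mt mem_singleton_iff.1 hb)] at hab
    exact hab.not_ge (indicator_nonneg (fun _ _ => zero_le_one) a)
  have ha : a ≠ 0 := by
    rintro rfl
    exact hab.ne (by rw [hb])
  have hd : Dense (A ∩ {0}ᶜ) :=
    (dense_of_mem_residual hA).inter_of_isOpen_right (dense_compl_singleton 0)
      isOpen_compl_singleton
  have huo : IsOpen (uIoo a b) := isOpen_Ioo
  obtain ⟨x, hx, hxA, hx0⟩ := hd.inter_open_nonempty (uIoo a b) huo
    (nonempty_Ioo.2 (min_lt_max.2 (hb ▸ ha)))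
  refine ⟨x, ⟨hxA, hx⟩, ?_⟩
  rw [indicator_of_notMem hx0, indicator_of_notMem (by simpa using ha), hb,
    indicator_of_mem (mem_singleton _)]
  constructor
  · simpa using hε
  · simp only [Pi.one_apply]
    linarith

theorem indicator_singleton_notMem_swiatkowskiFunctions :
    (({0} : Set ℝ).indicator 1 : ℝ → ℝ) ∉ swiatkowskiFunctions := by
  intro h
  have h0 : (({0} : Set ℝ).indicator 1 : ℝ → ℝ) 0 = 1 := indicator_of_mem (mem_singleton _) _
  have h1 : ∀ x : ℝ, 0 < x → (({0} : Set ℝ).indicator 1 : ℝ → ℝ) x = 0 := fun x hx =>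
    indicator_of_notMem (by simpa using hx.ne') _
  obtain ⟨x, hx, -, hxv⟩ := h 0 1 one_pos (by rw [h0, h1 1 one_pos]; exact one_ne_zero)
  rw [h0, h1 1 one_pos, h1 x hx.1, uIoo_of_gt one_pos] at hxv
  exact lt_irrefl _ hxv.1

/-- Take the values 1 and 2 on disjoint countable dense sets and 0 elsewhere. With `A` the
complement of both sets, `f` is 0 on `A`, which is not within `1 / 2` of the interval `(1, 2)`. -/
theorem exists_mem_bairePropertyFunctions_notMem_frakS :
    ∃ f ∈ bairePropertyFunctions, f ∉ frakS := by
  set Q : Set ℝ := range ((↑) : ℚ → ℝ) with hQ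
  set R : Set ℝ := (fun x => x + √2) '' Q with hR
  have hQc : Q.Countable := countable_range _
  have hRc : R.Countable := hQc.image _
  have hQd : Dense Q := Rat.denseRange_cast
  have hRd : Dense R := by
    have : DenseRange fun x : ℝ => x + √2 := (Homeomorph.addRight (√2)).surjective.denseRange
    exact this.dense_image (by fun_prop) hQd
  have hdisj : ∀ x ∈ R, x ∉ Q := by
    rintro _ ⟨_, ⟨r, rfl⟩, rfl⟩
    exact fun h => (irrational_sqrt_two.ratCast_add r) h
  set f : ℝ → ℝ := Q.indicator 1 + R.indicator 2 with hf
  have hfQ : ∀ x ∈ Q, f x = 1 := by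
    intro x hx
    simp [hf, hx, indicator_of_notMem (fun h => hdisj x h hx)]
  have hfR : ∀ x ∈ R, f x = 2 := by
    intro x hx
    simp [hf, hx, indicator_of_notMem (hdisj x hx)]
  have hf0 : ∀ x, x ∉ Q → x ∉ R → f x = 0 := by
    intro x h1 h2
    simp [hf, h1, h2]
  refine ⟨f, fun U hU => MeasurableSet.baireMeasurableSet
    (((measurable_one.indicator hQc.measurableSet).add
      ((measurable_const (a := (2 : ℝ))).indicator hRc.measurableSet)) hU.measurableSet), ?_⟩
  rintro ⟨-, hS⟩
  have hres : ∀ {s : Set ℝ}, s.Countable → sᶜ ∈ residual ℝ := fun {s} hs =>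
    residual_of_dense_Gδ hs.isGδ_compl (hs.dense_compl ℝ)
  obtain ⟨x, -, J, ⟨hJo, -, hJ⟩, hxJ⟩ := (hS (Qᶜ ∩ Rᶜ) (inter_mem (hres hQc) (hres hRc)) (1 / 2)
    one_half_pos).inter_open_nonempty univ isOpen_univ univ_nonempty
  obtain ⟨a, haJ, ha⟩ := hQd.inter_open_nonempty J hJo ⟨x, hxJ⟩
  obtain ⟨b, hbJ, hb⟩ := hRd.inter_open_nonempty J hJo ⟨x, hxJ⟩
  obtain ⟨y, ⟨⟨hyQ, hyR⟩, -⟩, hy⟩ := hJ a haJ b hbJ (by rw [hfQ a ha, hfR b hb]; norm_num)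
  rw [hfQ a ha, hf0 y hyQ hyR] at hy
  linarith [hy.1]

/-! ### Baire classes and the Baire order -/

theorem baireClass_one {X : Type*} (F : Set (X → ℝ)) : baireClass F 1 = LIM F := by
  rw [baireClass_of_pos F one_pos]
  congr 1
  ext f
  simp only [mem_iUnion, Subtype.exists, mem_Iio, Order.lt_one_iff, exists_prop, exists_eq_left,
    baireClass_zero]

theorem baireClass_one_swiatkowskiFunctions : baireClass swiatkowskiFunctions 1 = frakS :=
  (baireClass_one _).trans
    (LIM_swiatkowskiFunctions_subset_frakS.antisymm frakS_subset_LIM_swiatkowskiFunctions)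

theorem baireClass_swiatkowskiFunctions_subset (α : Ordinal.{0}) :
    baireClass swiatkowskiFunctions α ⊆ bairePropertyFunctions := by
  induction α using WellFoundedLT.induction with
  | _ α ih =>
    rcases eq_zero_or_pos α with rfl | hα
    · rw [baireClass_zero]
      exact swiatkowskiFunctions_subset_bairePropertyFunctions
    · rw [baireClass_of_pos _ hα, ← LIM_bairePropertyFunctions]
      exact LIM_mono (iUnion_subset fun β => ih β.1 β.2)

/-- Class 1 is already `frakS`, whose limits exhaust the functions with the Baire property, and no
class leaves them. -/
theorem baireClass_swiatkowskiFunctions_of_one_lt {α : Ordinal.{0}} (hα : 1 < α) :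
    baireClass swiatkowskiFunctions α = bairePropertyFunctions := by
  refine (baireClass_swiatkowskiFunctions_subset α).antisymm ?_
  rw [baireClass_of_pos _ (one_pos.trans hα)]
  refine bairePropertyFunctions_subset_LIM_frakS.trans (LIM_mono ?_)
  rw [← baireClass_one_swiatkowskiFunctions]
  exact subset_iUnion (fun β : Iio α => baireClass swiatkowskiFunctions β.1) ⟨1, hα⟩

theorem mainTheorem2 :
    baireClass swiatkowskiFunctions 1 = frakS ∧
    (∀ α : Ordinal.{0}, 1 < α → baireClass swiatkowskiFunctions α = bairePropertyFunctions) ∧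
    baireOrder swiatkowskiFunctions = 2 := by
  refine ⟨baireClass_one_swiatkowskiFunctions,
    fun α hα => baireClass_swiatkowskiFunctions_of_one_lt hα, ?_⟩
  have h12 : (1 : Ordinal.{0}) < 2 := one_lt_two
  have hleast : IsLeast {α : Ordinal.{0} | α ≤ Ordinal.omega 1 ∧
      baireClass swiatkowskiFunctions (Order.succ α) = baireClass swiatkowskiFunctions α} 2 := by
    refine ⟨⟨?_, ?_⟩, ?_⟩
    · exact (Ordinal.natCast_lt_omega0 2).le.trans (Ordinal.omega0_le_omega 1)
    · rw [baireClass_swiatkowskiFunctions_of_one_lt h12,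
        baireClass_swiatkowskiFunctions_of_one_lt (h12.trans (Order.lt_succ 2))]
    · rintro α ⟨-, hα⟩
      by_contra! hlt
      have hle : α ≤ 1 := by
        rwa [← Order.lt_succ_iff, Order.succ_eq_add_one, one_add_one_eq_two]
      rcases hle.lt_or_eq with h | rfl
      · obtain rfl : α = 0 := Order.lt_one_iff.1 h
        rw [baireClass_zero, Order.succ_eq_add_one, zero_add, baireClass_one_swiatkowskiFunctions] at hα
        exact indicator_singleton_notMem_swiatkowskiFunctions (hα ▸ indicator_singleton_mem_frakS)
      · rw [baireClass_swiatkowskiFunctions_of_one_lt (Order.lt_succ 1),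
          baireClass_one_swiatkowskiFunctions] at hα
        obtain ⟨f, hf, hf'⟩ := exists_mem_bairePropertyFunctions_notMem_frakS
        exact hf' (hα ▸ hf)
  exact hleast.csInf_eq
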